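/- **Setting.** Let $\mathcal S$ (states) and $\mathcal A$ (actions) be separable metric spaces with Borel reference measures $\mathrm ds$ ($\sigma$-finite) and $\mathrm da$. Each state $s$ has a measurable set $\mathcal A(s)\subseteq\mathcal A$ of available actions, and $T(s,a)\in\mathcal S$ is the state reached by $a\in\mathcal A(s)$. Write $s\to s'$ if $s'=T(s,a)$ for some $a\in\mathcal A(s)$; $\mathcal P(s')=\{s: s\to s'\}$, $\mathcal C(s)=\{s': s\to s'\}$; the set of pairs with $s\to s'$ is measurable. A trajectory is a finite sequence $(s_1,\dots,s_m)$ with $s_t\to s_{t+1}$; $s<s'$ means that a trajectory with at least one transition leads from $s$ to $s'$. There are distinct states $s_0,s_f$; complete trajectories are those from $s_0$ to $s_f$. Assume: 1. every trajectory is acyclic (its states are pairwise distinct), complete trajectories have bounded length, $s_0<s$ for all $s\ne s_0$, and $s<s_f$ for all $s\neq s_f$; 2. for $s\to s'$ the action $a\in\mathcal A(s)$ with $T(s,a)=s'$ is unique and depends continuously on $(s,s')$, and $a\mapsto T(s,a)$ carries $\mathrm da$ on $\mathcal A(s)$ to $\mathrm ds$ on $\mathcal C(s)$ (no Jacobian,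 as for translations $T(s,a)=s+a$); 3. $\{s_0\}$ and $\{s_f\}$ have $\mathrm ds$-mass $1$, and every relative neighbourhood of a point of $\mathcal A(s)$ in $\mathcal A(s)$, or of a point of $\mathcal P(s')$ in $\mathcal P(s')$, has positive measure. On finite sequences of states let $\mathrm d\tau$ be the product measure $\mathrm ds\otimes\cdots\otimes\mathrm ds$ on each length, summed over all lengths. A *flow* is a non-negative measurable function $F$ on complete trajectories, extended by $0$ to all other sequences. Its state flow $F(s)$, edge flow $F(s\to s')$ and prefix flow $F(p)$ are the integrals of $F(\tau)$ over the complete trajectories that pass through $s$, pass through $s\to s'$, or begin with $p$, respectively (integration being over the remaining states). $F$ is *Markovian* if for every trajectory $p$ from $s_0$ to $s$ with $0<F(p)<\infty$ and every $s\to s'$, $F(p,s')/F(p)=F(s\to s')/F(s)$ (with $0/0=0$). **Theorem.** Let $\hat F$ be a non-negative function, given on states as $\hat F(s)$ and on state–action pairs as $\hat F(s,a)$, where $\hat F(s,a)$ is Lipschitz in $a$ and in $s$ with a common constant. Put $\hat F(s\to s')=\hat F(s,a)$ for the action $a:s\to s'$. Then $\hat F$ corresponds to a flow, i.e. there is a flow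 $F$ with $F(s)=\hat F(s)$ for all $s$ and $F(s\to s')=\hat F(s\to s')$ for all $s\to s'$, if and only if $$\forall s'>s_0:\ \hat F(s')=\int_{\mathcal P(s')}\hat F(s\to s')\,\mathrm ds,\qquad \forall s'<s_f:\ \hat F(s')=\int_{\mathcal C(s')}\hat F(s'\to s'')\,\mathrm ds''=\int_{\mathcal A(s')}\hat F(s',a)\,\mathrm da .$$ In that case there is a Markovian flow $F$ matching $\hat F$ on all states and transitions, with $$F(\tau)=\frac{\prod_{t=1}^{n+1}\hat F(s_{t-1}\to s_t)}{\prod_{t=1}^{n}\hat F(s_t)}\quad\text{for every complete trajectory }\tau=(s_0,s_1,\dots,s_n,s_{n+1}=s_f)$$ (a quotient with denominator $0$ being read as $0$), and it is unique: every Markovian flow matching $\hat F$ equals $F$ for $\mathrm d\tau$-almost every $\tau$. -/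

import Mathlib

open MeasureTheory Topology
open scoped ENNReal NNReal

/-- The data of a continuous task: for every state `s` a set `acts s` of available actions, the
transition function `T`, the initial state `s₀`, the final state `sf`, and the reference measures
`ds` on states and `da` on actions. Values `T s a` with `a ∉ acts s` carry no meaning. -/
structure FlowTask (S A : Type*) [MeasurableSpace S] [MeasurableSpace A] where
  acts : S → Set A
  T : S → A → S
  s₀ : S
  sf : S
  ds : Measure S
  da : Measure A

namespace FlowTask

variable {S A : Type*} [MeasurableSpace S] [MeasurableSpace A]

/-- `s → s'` is a transition. -/
def Edge (M : FlowTask S A) (s s' : S) : Prop := ∃ a ∈ M.acts s, M.T s a = s'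

/-- The parent set. -/
def parents (M : FlowTask S A) (s' : S) : Set S := {s | M.Edge s s'}

/-- The child set. -/
def children (M : FlowTask S A) (s : S) : Set S := {s' | M.Edge s s'}

/-- `s < s'`: some trajectory leads from `s` to `s'`. -/
def Before (M : FlowTask S A) : S → S → Prop := Relation.TransGen M.Edge

/-- The action `a : s → s'`, meaningful if `s → s'` is a transition. -/
noncomputable def action [Nonempty A] (M : FlowTask S A) (s s' : S) : A :=
  Function.invFunOn (M.T s) (M.acts s) s'

/-- A trajectory is a finite sequence of states joined by transitions. -/
def IsTrajectory (M : FlowTask S A) (τ : List S) : Prop := τ.IsChain M.Edge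

/-- A trajectory that starts in the initial state. -/
def IsInitial (M : FlowTask S A) (τ : List S) : Prop :=
  M.IsTrajectory τ ∧ τ.head? = some M.s₀

/-- A complete trajectory leads from the initial state to the final state. -/
def IsComplete (M : FlowTask S A) (τ : List S) : Prop :=
  M.IsTrajectory τ ∧ τ.head? = some M.s₀ ∧ τ.getLast? = some M.sf

/-- The assumptions on a continuous acyclic task. -/
structure IsAcyclicTask [MetricSpace S] [MetricSpace A] [Nonempty A] (M : FlowTask S A) : Prop where
  sigmaFinite : SigmaFinite M.ds
  measurableSet_acts : ∀ s, MeasurableSet (M.acts s)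
  measurableSet_edges : MeasurableSet {e : S × S | M.Edge e.1 e.2}
  /-- Every trajectory is acyclic. -/
  acyclic : ∀ τ, M.IsTrajectory τ → τ.Nodup
  /-- The length of complete trajectories is bounded. -/
  horizon : ∃ N : ℕ, ∀ τ, M.IsComplete τ → τ.length ≤ N
  s₀_ne_sf : M.s₀ ≠ M.sf
  /-- The task is pointed: `s₀` comes before all other states, `sf` after all other states. -/
  s₀_before : ∀ s, s ≠ M.s₀ → M.Before M.s₀ s
  before_sf : ∀ s, s ≠ M.sf → M.Before s M.sf
  /-- The two distinguished states have unit mass, so that integrals over parents and children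
  see the transitions out of `s₀` and into `sf`. -/
  ds_s₀ : M.ds {M.s₀} = 1
  ds_sf : M.ds {M.sf} = 1
  /-- At most one action leads from a state to another one. -/
  unique_action : ∀ s, Set.InjOn (M.T s) (M.acts s)
  /-- Actions are translations: passing from actions to children costs no Jacobian, and the action
  depends continuously on the two states it joins (for `T s a = s + a`, it is `s' - s`). -/
  translation : ∀ s, MeasurePreserving (M.T s)
    (M.da.restrict (M.acts s)) (M.ds.restrict (M.children s))
  continuousOn_action : ContinuousOn (fun e : S × S ↦ M.action e.1 e.2) {e | M.Edge e.1 e.2}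
  /-- The reference measures have full support on the sets of available actions and of parents. -/
  da_pos : ∀ s, ∀ a ∈ M.acts s, ∀ U ∈ 𝓝 a, 0 < M.da (U ∩ M.acts s)
  ds_pos : ∀ s', ∀ s ∈ M.parents s', ∀ U ∈ 𝓝 s, 0 < M.ds (U ∩ M.parents s')

/-- The integral `∫ f(τ) dτ` over finite sequences of states, of all lengths, with respect to the
product measures `ds ⊗ ⋯ ⊗ ds`. -/
noncomputable def seqIntegral (M : FlowTask S A) (f : List S → ℝ≥0∞) : ℝ≥0∞ :=
  ∑' n : ℕ, ∫⁻ x : Fin n → S, f (List.ofFn x) ∂(Measure.pi fun _ ↦ M.ds)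

/-- A trajectory flow: a nonnegative measurable function on the set of complete trajectories,
extended by zero to all sequences of states. -/
structure TrajectoryFlow (M : FlowTask S A) where
  toFun : List S → ℝ≥0
  measurable_toFun : ∀ n : ℕ, Measurable fun x : Fin n → S ↦ toFun (List.ofFn x)
  eq_zero : ∀ τ, ¬ M.IsComplete τ → toFun τ = 0

namespace TrajectoryFlow

variable {M : FlowTask S A}

/-- `F(s)`: the integral of `F(τ)` over the complete trajectories through `s`; the integration is
over the part `p` of `τ` before `s` and the part `q` after it. -/
noncomputable def stateFlow (F : M.TrajectoryFlow) (s : S) : ℝ≥0∞ :=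
  M.seqIntegral fun p ↦ M.seqIntegral fun q ↦ (F.toFun (p ++ s :: q) : ℝ≥0∞)

/-- `F(s → s')`: the integral of `F(τ)` over the complete trajectories through `s → s'`. -/
noncomputable def edgeFlow (F : M.TrajectoryFlow) (s s' : S) : ℝ≥0∞ :=
  M.seqIntegral fun p ↦ M.seqIntegral fun q ↦ (F.toFun (p ++ s :: s' :: q) : ℝ≥0∞)

/-- The integral of `F(τ)` over the complete trajectories that begin with `p`. -/
noncomputable def prefixFlow (F : M.TrajectoryFlow) (p : List S) : ℝ≥0∞ :=
  M.seqIntegral fun q ↦ (F.toFun (p ++ q) : ℝ≥0∞)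

/-- Markovian flow: `P(s → s' | τ) = P(s → s' | s) = F(s → s') / F(s)` for every trajectory `τ`
from `s₀` to `s`, the left side being defined when the flow that begins with `τ` is positive
and finite. -/
def IsMarkovian (F : M.TrajectoryFlow) : Prop :=
  ∀ (p : List S) (s s' : S), M.IsInitial (p ++ [s]) → M.Edge s s' →
    F.prefixFlow (p ++ [s]) ≠ 0 → F.prefixFlow (p ++ [s]) ≠ ∞ →
      F.prefixFlow (p ++ [s, s']) / F.prefixFlow (p ++ [s]) = F.edgeFlow s s' / F.stateFlow s

end TrajectoryFlow

/-- `F̂(s → s')`, the value of `F̂(s, a)` at the action `a : s → s'`. -/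
noncomputable def onEdge [Nonempty A] (M : FlowTask S A) (Fa : S → A → ℝ≥0) (s s' : S) : ℝ≥0 :=
  Fa s (M.action s s')

/-- The flow `F` matches `F̂`, given by `Fs` on states and by `Fa` on state-action pairs. -/
def Matches [Nonempty A] (M : FlowTask S A) (Fs : S → ℝ≥0) (Fa : S → A → ℝ≥0)
    (F : M.TrajectoryFlow) : Prop :=
  (∀ s, F.stateFlow s = Fs s) ∧ ∀ s s', M.Edge s s' → F.edgeFlow s s' = M.onEdge Fa s s'

/-- The continuous flow matching conditions. -/
def FlowMatching [Nonempty A] (M : FlowTask S A) (Fs : S → ℝ≥0) (Fa : S → A → ℝ≥0) : Prop :=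
  (∀ s', M.Before M.s₀ s' →
    (Fs s' : ℝ≥0∞) = ∫⁻ s in M.parents s', (M.onEdge Fa s s' : ℝ≥0∞) ∂M.ds) ∧
  (∀ s', M.Before s' M.sf →
    (Fs s' : ℝ≥0∞) = ∫⁻ s'' in M.children s', (M.onEdge Fa s' s'' : ℝ≥0∞) ∂M.ds ∧
    (Fs s' : ℝ≥0∞) = ∫⁻ a in M.acts s', (Fa s' a : ℝ≥0∞) ∂M.da)

end FlowTask

/-! Necessity is Tonelli. Cutting a complete trajectory at `s'`, one integrates over the last state
before `s'` or the first state after it; this writes the state flow as the integral of edge flows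
over parents or over children. The translation property turns the integral over children into one
over actions.

For sufficiency, let trajectories branch with weights K(s, s') = F̂(s → s') / F̂(s) on transitions
and 0 elsewhere, starting with mass F̂(s₀) and counting only those that end in `sf`. The flow
through a prefix is then the weight of the prefix (`headWeight`) times the total weight of its
continuations to `sf` (`tailMass`). The outflow condition makes K(s, ·) a probability density
wherever F̂(s) ≠ 0, so backward induction gives tail mass 1 there (`tailMass_eq_one`). The inflow
condition and forward induction show that the head weights of all prefixes ending in s integrate to
F̂(s) (`seqIntegral_headWeight`). Both inductions are well-founded because trajectories have bounded
length. State flows, edge flows and the Markov property follow.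

States with F̂(s) = 0 must not spoil these identities, which are asserted at every point and not
only almost everywhere. An integral of F̂ over the transitions into or out of such a state vanishes,
and continuity with full support then makes F̂ vanish on each of these transitions.

For uniqueness, the Markov property and the matching determine the flow of a prefix from that of the
prefix one state shorter, so all prefix flows agree almost everywhere with the head weights. At a
complete trajectory nothing can follow `sf`, and the prefix flow is F(τ) itself. -/

/-! ### Measurable families of lists -/

/-- A measurable family of lists of one common length. -/
def MeasurableListMap {α S : Type*} [MeasurableSpace α] [MeasurableSpace S] (u : α → List S) :
    Prop :=
  ∃ (n : ℕ) (v : α → Fin n → S), Measurable v ∧ ∀ a, u a = List.ofFn (v a)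

namespace MeasurableListMap

variable {α S : Type*} [MeasurableSpace α] [MeasurableSpace S] {u u' : α → List S}

theorem ofFn {n : ℕ} {v : α → Fin n → S} (hv : Measurable v) :
    MeasurableListMap fun a ↦ List.ofFn (v a) := ⟨n, v, hv, fun _ ↦ rfl⟩

theorem nil : MeasurableListMap fun _ : α ↦ ([] : List S) :=
  ⟨0, fun _ ↦ Fin.elim0, measurable_const, fun _ ↦ by simp⟩

theorem cons {s : α → S} (hs : Measurable s) (hu : MeasurableListMap u) :
    MeasurableListMap fun a ↦ s a :: u a := by
  obtain ⟨n, v, hv, h⟩ := hu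
  refine ⟨n + 1, fun a ↦ Fin.cons (s a) (v a), ?_, fun a ↦ by simp only [List.ofFn_cons, h]⟩
  rw [measurable_pi_iff]
  intro i
  refine Fin.cases ?_ (fun j ↦ ?_) i
  · simpa using hs
  · simpa using measurable_pi_iff.1 hv j

theorem append (hu : MeasurableListMap u) (hu' : MeasurableListMap u') :
    MeasurableListMap fun a ↦ u a ++ u' a := by
  obtain ⟨n, v, hv, h⟩ := hu
  obtain ⟨n', v', hv', h'⟩ := hu'
  refine ⟨n + n', fun a ↦ Fin.append (v a) (v' a), ?_, fun a ↦ by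
    simp only [List.ofFn_fin_append, h, h']⟩
  rw [measurable_pi_iff]
  intro i
  refine Fin.addCases (fun j ↦ ?_) (fun j ↦ ?_) i
  · simpa using measurable_pi_iff.1 hv j
  · simpa using measurable_pi_iff.1 hv' j

theorem const (p : List S) : MeasurableListMap fun _ : α ↦ p :=
  ⟨p.length, fun _ ↦ p.get, measurable_const, fun _ ↦ (List.ofFn_get p).symm⟩

theorem comp {β : Type*} [MeasurableSpace β] (hu : MeasurableListMap u) {g : β → α}
    (hg : Measurable g) : MeasurableListMap fun b ↦ u (g b) := by
  obtain ⟨n, v, hv, h⟩ := hu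
  exact ⟨n, fun b ↦ v (g b), hv.comp hg, fun b ↦ h _⟩

theorem measurable_comp {β : Type*} [MeasurableSpace β] {f : List S → β}
    (hf : ∀ n : ℕ, Measurable fun x : Fin n → S ↦ f (List.ofFn x)) (hu : MeasurableListMap u) :
    Measurable fun a ↦ f (u a) := by
  obtain ⟨n, v, hv, h⟩ := hu
  simp_rw [h]
  exact (hf n).comp hv

end MeasurableListMap

/-! ### Splitting one coordinate off a product measure -/

theorem lintegral_pi_cons {S : Type*} [MeasurableSpace S] (μ : Measure S) [SigmaFinite μ] {n : ℕ}
    {f : (Fin (n + 1) → S) → ℝ≥0∞} (hf : Measurable f) :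
    ∫⁻ x, f x ∂(Measure.pi fun _ ↦ μ) =
      ∫⁻ s, ∫⁻ y : Fin n → S, f (Fin.cons s y) ∂(Measure.pi fun _ ↦ μ) ∂μ := by
  have h := (measurePreserving_piFinSuccAbove (fun _ : Fin (n + 1) ↦ μ) 0).symm
  rw [← h.lintegral_comp hf, lintegral_prod]
  · simp [MeasurableEquiv.piFinSuccAbove_symm_apply, Fin.insertNthEquiv]
  · exact (hf.comp (MeasurableEquiv.measurable _)).aemeasurable

theorem lintegral_pi_snoc {S : Type*} [MeasurableSpace S] (μ : Measure S) [SigmaFinite μ] {n : ℕ}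
    {f : (Fin (n + 1) → S) → ℝ≥0∞} (hf : Measurable f) :
    ∫⁻ x, f x ∂(Measure.pi fun _ ↦ μ) =
      ∫⁻ y : Fin n → S, ∫⁻ s, f (Fin.snoc (α := fun _ ↦ S) y s) ∂μ ∂(Measure.pi fun _ ↦ μ) := by
  have h := (measurePreserving_piFinSuccAbove (fun _ : Fin (n + 1) ↦ μ) (Fin.last n)).symm
  rw [← h.lintegral_comp hf, lintegral_prod_symm]
  · simp [MeasurableEquiv.piFinSuccAbove_symm_apply, Fin.insertNthEquiv]
  · exact (hf.comp (MeasurableEquiv.measurable _)).aemeasurable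

/-- Tonelli applied to the indicator of the exceptional set. This is what lets an almost everywhere
statement grow by one state at a time. -/
theorem ae_pi_of_ae_ae_snoc {S : Type*} [MeasurableSpace S] {μ : Measure S} [SigmaFinite μ]
    {n : ℕ} {P : (Fin (n + 1) → S) → Prop} (hP : MeasurableSet {x | P x})
    (h : ∀ᵐ y ∂(Measure.pi fun _ : Fin n ↦ μ), ∀ᵐ s ∂μ, P (Fin.snoc (α := fun _ ↦ S) y s)) :
    ∀ᵐ x ∂(Measure.pi fun _ : Fin (n + 1) ↦ μ), P x := by
  have hm : Measurable ({x | P x}ᶜ.indicator fun _ ↦ (1 : ℝ≥0∞)) :=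
    measurable_const.indicator hP.compl
  rw [ae_iff, show {x | ¬ P x} = {x | P x}ᶜ from rfl, ← lintegral_indicator_one hP.compl]
  refine (lintegral_pi_snoc μ hm).trans ?_
  rw [← lintegral_zero]
  refine lintegral_congr_ae ?_
  filter_upwards [h] with y hy
  rw [← lintegral_zero]
  refine lintegral_congr_ae ?_
  filter_upwards [hy] with s hs
  exact Set.indicator_of_notMem (s := {x | P x}ᶜ) (Set.notMem_compl_iff.2 hs) _

theorem List.ofFn_snoc {S : Type*} {n : ℕ} (y : Fin n → S) (s : S) :
    List.ofFn (Fin.snoc (α := fun _ ↦ S) y s) = List.ofFn y ++ [s] := by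
  rw [List.ofFn_succ']
  simp

/-! ### Integration over finite sequences of all lengths -/

namespace FlowTask

variable {S A : Type*} [MeasurableSpace S] [MeasurableSpace A] (M : FlowTask S A)

theorem measurable_seqIntegral [SigmaFinite M.ds] {α : Type*} [MeasurableSpace α]
    {f : α → List S → ℝ≥0∞}
    (hf : ∀ n, Measurable fun z : α × (Fin n → S) ↦ f z.1 (List.ofFn z.2)) :
    Measurable fun a ↦ M.seqIntegral (f a) :=
  Measurable.tsum fun n ↦ (hf n).lintegral_prod_right'

/-- The product measure on length 0 is a unit point mass, which gives the term `f []`; on each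
positive length Tonelli separates the first coordinate. -/
theorem seqIntegral_cons [SigmaFinite M.ds] {f : List S → ℝ≥0∞}
    (hf : ∀ n : ℕ, Measurable fun x : Fin n → S ↦ f (List.ofFn x)) :
    M.seqIntegral f = f [] + ∫⁻ s, M.seqIntegral (fun q ↦ f (s :: q)) ∂M.ds := by
  rw [seqIntegral, tsum_eq_zero_add' ENNReal.summable]
  congr 1
  · simp
  · simp only [seqIntegral]
    rw [lintegral_tsum]
    · refine tsum_congr fun n ↦ ?_
      rw [lintegral_pi_cons M.ds (hf (n + 1))]
      simp only [List.ofFn_cons]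
    · intro n
      refine Measurable.aemeasurable (Measurable.lintegral_prod_right'
        (f := fun z : S × (Fin n → S) ↦ f (z.1 :: List.ofFn z.2)) ?_)
      exact ((MeasurableListMap.ofFn measurable_snd).cons measurable_fst).measurable_comp hf

theorem lintegral_seqIntegral_comm [SigmaFinite M.ds] {f : S → List S → ℝ≥0∞}
    (hf : ∀ n : ℕ, Measurable fun z : S × (Fin n → S) ↦ f z.1 (List.ofFn z.2)) :
    ∫⁻ s, M.seqIntegral (f s) ∂M.ds = M.seqIntegral fun p ↦ ∫⁻ s, f s p ∂M.ds := by
  simp only [seqIntegral]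
  rw [lintegral_tsum fun n ↦ (hf n).lintegral_prod_right'.aemeasurable]
  exact tsum_congr fun n ↦ lintegral_lintegral_swap (hf n).aemeasurable

theorem seqIntegral_snoc [SigmaFinite M.ds] {f : List S → ℝ≥0∞}
    (hf : ∀ n : ℕ, Measurable fun x : Fin n → S ↦ f (List.ofFn x)) :
    M.seqIntegral f = f [] + ∫⁻ s, M.seqIntegral (fun p ↦ f (p ++ [s])) ∂M.ds := by
  rw [lintegral_seqIntegral_comm M fun n ↦ (((MeasurableListMap.ofFn measurable_snd).append
    (MeasurableListMap.nil.cons measurable_fst)).measurable_comp hf),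
    seqIntegral, tsum_eq_zero_add' ENNReal.summable]
  congr 1
  · simp
  · refine tsum_congr fun n ↦ ?_
    rw [lintegral_pi_snoc M.ds (hf (n + 1))]
    simp only [List.ofFn_snoc]

theorem seqIntegral_const_mul {c : ℝ≥0∞} {f : List S → ℝ≥0∞}
    (hf : ∀ n : ℕ, Measurable fun x : Fin n → S ↦ f (List.ofFn x)) :
    (M.seqIntegral fun p ↦ c * f p) = c * M.seqIntegral f := by
  simp only [seqIntegral]
  rw [← ENNReal.tsum_mul_left]
  exact tsum_congr fun n ↦ lintegral_const_mul _ (hf n)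

theorem seqIntegral_mul_const {c : ℝ≥0∞} {f : List S → ℝ≥0∞}
    (hf : ∀ n : ℕ, Measurable fun x : Fin n → S ↦ f (List.ofFn x)) :
    (M.seqIntegral fun p ↦ f p * c) = M.seqIntegral f * c := by
  simp only [mul_comm _ c]
  exact M.seqIntegral_const_mul hf

@[simp]
theorem seqIntegral_zero : (M.seqIntegral fun _ ↦ 0) = 0 := by simp [seqIntegral]

theorem seqIntegral_eq_nil {f : List S → ℝ≥0∞} (hf : ∀ q, q ≠ [] → f q = 0) :
    M.seqIntegral f = f [] := by
  rw [seqIntegral, tsum_eq_single 0]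
  · simp
  · intro n hn
    rw [lintegral_congr (g := fun _ ↦ 0) fun x ↦ hf _ (by simpa using hn), lintegral_zero]

theorem exists_ne_zero_of_seqIntegral_ne_zero {f : List S → ℝ≥0∞} (h : M.seqIntegral f ≠ 0) :
    ∃ p, f p ≠ 0 := by
  by_contra! hf
  exact h (by simp [seqIntegral, hf])

end FlowTask

/-! ### Order structure of an acyclic task -/

namespace FlowTask

variable {S A : Type*} [MeasurableSpace S] [MeasurableSpace A] {M : FlowTask S A}

theorem IsComplete.isInitial_append {p q : List S} (hp : p ≠ []) (h : M.IsComplete (p ++ q)) :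
    M.IsInitial p := by
  obtain ⟨h1, h2, -⟩ := h
  refine ⟨(List.isChain_append.1 h1).1, ?_⟩
  cases p with
  | nil => exact absurd rfl hp
  | cons a p => simpa using h2

namespace IsAcyclicTask

variable [MetricSpace S] [MetricSpace A] [Nonempty A]

/-- A path from `s` back to `s` would be a trajectory that repeats `s`. -/
theorem not_before_self (hM : M.IsAcyclicTask) (s : S) : ¬ M.Before s s := by
  intro h
  obtain ⟨t, hst, hts⟩ := Relation.TransGen.head'_iff.1 h
  obtain ⟨l, hl, hlast⟩ := List.exists_isChain_cons_of_relationReflTransGen hts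
  have := hM.acyclic (s :: t :: l) (hl.cons_cons hst)
  rw [List.nodup_cons] at this
  exact this.1 (hlast ▸ List.getLast_mem _)

theorem not_edge_s₀ (hM : M.IsAcyclicTask) (s : S) : ¬ M.Edge s M.s₀ := by
  intro h
  by_cases hs : s = M.s₀
  · subst hs
    exact hM.not_before_self _ (.single h)
  · exact hM.not_before_self _ ((hM.s₀_before s hs).tail h)

theorem not_edge_sf (hM : M.IsAcyclicTask) (s : S) : ¬ M.Edge M.sf s := by
  intro h
  by_cases hs : s = M.sf
  · subst hs
    exact hM.not_before_self _ (.single h)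
  · exact hM.not_before_self _ ((hM.before_sf s hs).head h)

theorem ne_s₀_of_edge (hM : M.IsAcyclicTask) {s s' : S} (h : M.Edge s s') : s' ≠ M.s₀ := by
  rintro rfl
  exact hM.not_edge_s₀ _ h

theorem ne_sf_of_edge (hM : M.IsAcyclicTask) {s s' : S} (h : M.Edge s s') : s ≠ M.sf := by
  rintro rfl
  exact hM.not_edge_sf _ h

theorem before_iff_ne_s₀ (hM : M.IsAcyclicTask) {s : S} : M.Before M.s₀ s ↔ s ≠ M.s₀ :=
  ⟨by rintro h rfl; exact hM.not_before_self _ h, hM.s₀_before s⟩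

theorem before_iff_ne_sf (hM : M.IsAcyclicTask) {s : S} : M.Before s M.sf ↔ s ≠ M.sf :=
  ⟨by rintro h rfl; exact hM.not_before_self _ h, hM.before_sf s⟩

theorem reflTransGen_s₀ (hM : M.IsAcyclicTask) (s : S) : Relation.ReflTransGen M.Edge M.s₀ s := by
  by_cases h : s = M.s₀
  · rw [h]
  · exact (hM.s₀_before s h).to_reflTransGen

theorem reflTransGen_sf (hM : M.IsAcyclicTask) (s : S) : Relation.ReflTransGen M.Edge s M.sf := by
  by_cases h : s = M.sf
  · rw [h]
  · exact (hM.before_sf s h).to_reflTransGen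

/-- Every trajectory is part of a complete one. -/
theorem exists_isComplete (hM : M.IsAcyclicTask) {τ : List S} (hτ : M.IsTrajectory τ)
    (hne : τ ≠ []) : ∃ p q, M.IsComplete (p ++ τ ++ q) := by
  obtain ⟨l, hl, hlast⟩ := List.exists_isChain_cons_of_relationReflTransGen
    (hM.reflTransGen_s₀ (τ.head hne))
  obtain ⟨l', hl', hlast'⟩ := List.exists_isChain_cons_of_relationReflTransGen
    (hM.reflTransGen_sf (τ.getLast hne))
  obtain ⟨a, t, rfl⟩ := List.exists_cons_of_ne_nil hne
  -- Two decompositions of the trajectory are needed: its head `a` for gluing on the left, its last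
  -- state `b` for gluing on the right.
  obtain ⟨i, b, hi⟩ := List.eq_nil_or_concat (a :: t) |>.resolve_left (by simp)
  have hb : (a :: t).getLast hne = b := by simp [hi]
  rw [hb] at hl' hlast'
  simp only [List.head_cons] at hlast
  -- The path from `s₀` already ends in `a`, so its last state is dropped to avoid listing `a`
  -- twice.
  have h1 : M.s₀ :: l = (M.s₀ :: l).dropLast ++ [a] := by
    rw [← hlast, List.dropLast_append_getLast]
  have h2 : ((M.s₀ :: l).dropLast ++ a :: t).IsChain M.Edge :=
    List.isChain_split.2 ⟨h1 ▸ hl, hτ⟩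
  refine ⟨(M.s₀ :: l).dropLast, l', ?_, ?_, ?_⟩
  · have h3 : (M.s₀ :: l).dropLast ++ a :: t ++ l' = ((M.s₀ :: l).dropLast ++ i) ++ b :: l' := by
      rw [hi]; simp
    rw [h3]
    refine List.isChain_split.2 ⟨?_, hl'⟩
    rw [hi] at h2
    simpa using h2
  · cases l with
    | nil => simpa using hlast.symm
    | cons c l => simp
  · rw [hi]
    rw [List.getLast?_eq_some_getLast (by simp), ← hlast']
    cases l' <;> simp

theorem exists_length_le (hM : M.IsAcyclicTask) :
    ∃ N : ℕ, ∀ τ, M.IsTrajectory τ → τ.length ≤ N := by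
  obtain ⟨N, hN⟩ := hM.horizon
  refine ⟨N, fun τ hτ ↦ ?_⟩
  by_cases hne : τ = []
  · simp [hne]
  · obtain ⟨p, q, h⟩ := hM.exists_isComplete hτ hne
    have := hN _ h
    simp only [List.length_append] at this
    omega

/-- `N + 1` terms of an infinite descending chain would form a trajectory longer than the bound `N`.
The chain runs against the arrows, hence the reversal. -/
theorem wellFounded_edge (hM : M.IsAcyclicTask) : WellFounded M.Edge := by
  obtain ⟨N, hN⟩ := hM.exists_length_le
  rw [wellFounded_iff_isEmpty_descending_chain]
  refine ⟨fun ⟨f, hf⟩ ↦ ?_⟩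
  have := hN (List.ofFn fun i : Fin (N + 1) ↦ f i).reverse (List.isChain_reverse.2 <| by
    rw [List.isChain_ofFn]
    intro i hi
    exact hf i)
  simp at this

theorem wellFounded_edge_swap (hM : M.IsAcyclicTask) :
    WellFounded (fun s s' ↦ M.Edge s' s) := by
  obtain ⟨N, hN⟩ := hM.exists_length_le
  rw [wellFounded_iff_isEmpty_descending_chain]
  refine ⟨fun ⟨f, hf⟩ ↦ ?_⟩
  have := hN (List.ofFn fun i : Fin (N + 1) ↦ f i) (by
    rw [IsTrajectory, List.isChain_ofFn]
    intro i hi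
    exact hf i)
  simp at this

theorem eq_nil_of_isComplete_s₀ (hM : M.IsAcyclicTask) {p q : List S}
    (h : M.IsComplete (p ++ M.s₀ :: q)) : p = [] := by
  cases p with
  | nil => rfl
  | cons a p =>
    obtain ⟨h1, h2, -⟩ := h
    have h3 := hM.acyclic _ h1
    simp only [List.cons_append, List.head?_cons, Option.some.injEq] at h2
    simp [h2] at h3

theorem eq_nil_of_isComplete_sf (hM : M.IsAcyclicTask) {p q : List S}
    (h : M.IsComplete (p ++ M.sf :: q)) : q = [] := by
  cases q with
  | nil => rfl
  | cons a q => exact absurd (List.isChain_append_cons_cons.1 h.1).2.1 (hM.not_edge_sf a)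

end IsAcyclicTask

end FlowTask

/-- A nonzero value at a point of `E` persists on a relative neighbourhood, which has positive
measure, whereas the zero integral makes `f` vanish almost everywhere on `E`. -/
theorem ContinuousOn.eq_zero_of_setLIntegral_eq_zero {X : Type*} [TopologicalSpace X]
    [MeasurableSpace X] [OpensMeasurableSpace X] {μ : Measure X}
    {E : Set X} (hE : MeasurableSet E) {f : X → ℝ≥0} (hf : ContinuousOn f E)
    (hμ : ∀ x ∈ E, ∀ U ∈ 𝓝 x, 0 < μ (U ∩ E)) (h : ∫⁻ x in E, (f x : ℝ≥0∞) ∂μ = 0) :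
    ∀ x ∈ E, f x = 0 := by
  intro x hx
  by_contra hne
  rw [lintegral_eq_zero_iff' (hf.aemeasurable hE).coe_nnreal_ennreal] at h
  have h1 : ∀ᶠ y in 𝓝[E] x, f y ≠ 0 := (hf x hx).eventually_ne hne
  obtain ⟨U, hU, hUE⟩ := mem_nhdsWithin_iff_exists_mem_nhds_inter.1 h1
  refine (hμ x hx U hU).ne' ?_
  rw [Filter.EventuallyEq, ae_restrict_iff' hE] at h
  refine measure_mono_null (fun y hy ↦ ?_) h
  simp only [Set.mem_compl_iff, Set.mem_ofPred_eq, not_forall]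
  exact ⟨hy.2, by simpa using hUE hy⟩

/-! ### Prefix, state and edge flows of an arbitrary flow -/

namespace FlowTask

variable {S A : Type*} [MeasurableSpace S] [MeasurableSpace A] {M : FlowTask S A}

theorem action_mem [Nonempty A] {s s' : S} (h : M.Edge s s') : M.action s s' ∈ M.acts s :=
  Function.invFunOn_mem h

namespace TrajectoryFlow

theorem isComplete_of_ne_zero (F : M.TrajectoryFlow) {τ : List S} (h : F.toFun τ ≠ 0) :
    M.IsComplete τ := by
  by_contra h'
  exact h (F.eq_zero τ h')

theorem measurable_comp (F : M.TrajectoryFlow) {α : Type*} [MeasurableSpace α] {u : α → List S}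
    (hu : MeasurableListMap u) : Measurable fun a ↦ (F.toFun (u a) : ℝ≥0∞) :=
  (hu.measurable_comp F.measurable_toFun).coe_nnreal_ennreal

theorem measurable_prefixFlow [SigmaFinite M.ds] (F : M.TrajectoryFlow) {α : Type*}
    [MeasurableSpace α] {u : α → List S} (hu : MeasurableListMap u) :
    Measurable fun a ↦ F.prefixFlow (u a) :=
  M.measurable_seqIntegral fun _ ↦
    F.measurable_comp ((hu.comp measurable_fst).append (.ofFn measurable_snd))

theorem stateFlow_eq_seqIntegral_prefixFlow (F : M.TrajectoryFlow) (s : S) :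
    F.stateFlow s = M.seqIntegral fun p ↦ F.prefixFlow (p ++ [s]) := by
  simp [stateFlow, prefixFlow]

theorem edgeFlow_eq_seqIntegral_prefixFlow (F : M.TrajectoryFlow) (s s' : S) :
    F.edgeFlow s s' = M.seqIntegral fun p ↦ F.prefixFlow (p ++ [s, s']) := by
  simp [edgeFlow, prefixFlow]

theorem isInitial_of_prefixFlow_ne_zero (F : M.TrajectoryFlow) {p : List S} (hp : p ≠ [])
    (h : F.prefixFlow p ≠ 0) : M.IsInitial p := by
  obtain ⟨q, hq⟩ := M.exists_ne_zero_of_seqIntegral_ne_zero h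
  exact (F.isComplete_of_ne_zero (by simpa using hq)).isInitial_append hp

theorem prefixFlow_eq_zero_of_not_edge (F : M.TrajectoryFlow) (p : List S) {s s' : S}
    (h : ¬ M.Edge s s') : F.prefixFlow (p ++ [s, s']) = 0 := by
  by_contra hne
  have := (F.isInitial_of_prefixFlow_ne_zero (by simp) hne).1
  exact h (List.isChain_append_cons_cons.1 this).2.1

theorem edgeFlow_eq_zero (F : M.TrajectoryFlow) {s s' : S} (h : ¬ M.Edge s s') :
    F.edgeFlow s s' = 0 := by
  simp [edgeFlow_eq_seqIntegral_prefixFlow, F.prefixFlow_eq_zero_of_not_edge _ h]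

/-- A trajectory beginning with `p` either stops there or has a next state. -/
theorem prefixFlow_eq_add_lintegral [SigmaFinite M.ds] (F : M.TrajectoryFlow) (p : List S) :
    F.prefixFlow p = F.toFun p + ∫⁻ s, F.prefixFlow (p ++ [s]) ∂M.ds := by
  rw [prefixFlow, seqIntegral_cons M fun n ↦
    F.measurable_comp ((MeasurableListMap.const p).append (.ofFn measurable_id))]
  simp [prefixFlow]

theorem stateFlow_eq_lintegral_edgeFlow_left [SigmaFinite M.ds] (F : M.TrajectoryFlow) {s' : S}
    (h : s' ≠ M.s₀) : F.stateFlow s' = ∫⁻ s, F.edgeFlow s s' ∂M.ds := by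
  rw [stateFlow_eq_seqIntegral_prefixFlow,
    seqIntegral_snoc M (f := fun p ↦ F.prefixFlow (p ++ [s'])) fun n ↦
    F.measurable_prefixFlow (.append (.ofFn measurable_id) (.const _))]
  -- The empty past contributes nothing, since a complete trajectory cannot start at `s' ≠ s₀`.
  have h0 : F.prefixFlow ([] ++ [s']) = 0 := by
    by_contra hne
    have := (F.isInitial_of_prefixFlow_ne_zero (by simp) hne).2
    exact h (by simpa using this)
  rw [h0, zero_add]
  simp [edgeFlow_eq_seqIntegral_prefixFlow]

theorem stateFlow_eq_lintegral_edgeFlow_right [SigmaFinite M.ds] (F : M.TrajectoryFlow) {s : S}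
    (h : s ≠ M.sf) : F.stateFlow s = ∫⁻ s', F.edgeFlow s s' ∂M.ds := by
  -- No complete trajectory stops at `s ≠ sf`, so only those with a next state remain.
  have h0 : ∀ p, F.toFun (p ++ [s]) = 0 := fun p ↦ F.eq_zero _ fun hc ↦ h (by simpa using hc.2.2)
  simp_rw [edgeFlow_eq_seqIntegral_prefixFlow]
  rw [stateFlow_eq_seqIntegral_prefixFlow, lintegral_seqIntegral_comm]
  · simp_rw [F.prefixFlow_eq_add_lintegral (_ ++ [s]), h0]
    simp
  · exact fun n ↦ F.measurable_prefixFlow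
      (.append (.ofFn measurable_snd) (.cons measurable_const (.cons measurable_fst .nil)))

end TrajectoryFlow

/-! ### Necessity of flow matching, and vanishing of edges at zero states -/

section

variable [MetricSpace S] [MetricSpace A] [Nonempty A]
  {Fs : S → ℝ≥0} {Fa : S → A → ℝ≥0} {L : ℝ≥0}

namespace IsAcyclicTask

theorem measurableSet_children (hM : M.IsAcyclicTask) (s : S) : MeasurableSet (M.children s) :=
  measurable_prodMk_left (x := s) hM.measurableSet_edges

theorem measurableSet_parents (hM : M.IsAcyclicTask) (s : S) : MeasurableSet (M.parents s) :=
  measurable_prodMk_right (y := s) hM.measurableSet_edges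

/-- Continuity in the action and a Lipschitz constant in the state common to all actions give joint
continuity of `Fa`, which is composed with the continuous choice of action. -/
theorem continuousOn_onEdge (hM : M.IsAcyclicTask) (hLa : ∀ s, LipschitzWith L fun a ↦ Fa s a)
    (hLs : ∀ a, LipschitzWith L fun s ↦ Fa s a) :
    ContinuousOn (fun e : S × S ↦ M.onEdge Fa e.1 e.2) {e | M.Edge e.1 e.2} := by
  have h : Continuous fun z : S × A ↦ Fa z.1 z.2 :=
    continuous_prod_of_continuous_lipschitzWith _ L (fun s ↦ (hLa s).continuous) hLs
  exact h.comp_continuousOn (continuousOn_fst.prodMk hM.continuousOn_action)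

theorem continuousOn_onEdge_children (hM : M.IsAcyclicTask)
    (hLa : ∀ s, LipschitzWith L fun a ↦ Fa s a)
    (hLs : ∀ a, LipschitzWith L fun s ↦ Fa s a) (s : S) :
    ContinuousOn (fun s' ↦ M.onEdge Fa s s') (M.children s) :=
  (hM.continuousOn_onEdge hLa hLs).comp (f := fun s' ↦ (s, s')) (by fun_prop) fun _ h ↦ h

theorem continuousOn_onEdge_parents (hM : M.IsAcyclicTask)
    (hLa : ∀ s, LipschitzWith L fun a ↦ Fa s a)
    (hLs : ∀ a, LipschitzWith L fun s ↦ Fa s a) (s' : S) :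
    ContinuousOn (fun s ↦ M.onEdge Fa s s') (M.parents s') :=
  (hM.continuousOn_onEdge hLa hLs).comp (f := fun s ↦ (s, s')) (by fun_prop) fun _ h ↦ h

theorem onEdge_eq_zero_of_left [OpensMeasurableSpace A] (hM : M.IsAcyclicTask)
    (hLa : ∀ s, LipschitzWith L fun a ↦ Fa s a)
    (hF : M.FlowMatching Fs Fa) {s s' : S} (h : M.Edge s s') (hs : Fs s = 0) :
    M.onEdge Fa s s' = 0 := by
  have h1 := (hF.2 s (hM.before_iff_ne_sf.2 (hM.ne_sf_of_edge h))).2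
  rw [hs, ENNReal.coe_zero] at h1
  exact (hLa s).continuous.continuousOn.eq_zero_of_setLIntegral_eq_zero (hM.measurableSet_acts s)
    (hM.da_pos s) h1.symm _ (action_mem h)

variable [OpensMeasurableSpace S]

/-- Change of variables along `M.T s`; since that map is injective on the available actions, the
action chosen for `T s a` is `a`. -/
theorem lintegral_acts_eq (hM : M.IsAcyclicTask) (hLa : ∀ s, LipschitzWith L fun a ↦ Fa s a)
    (hLs : ∀ a, LipschitzWith L fun s ↦ Fa s a) (s : S) :
    ∫⁻ a in M.acts s, (Fa s a : ℝ≥0∞) ∂M.da =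
      ∫⁻ s' in M.children s, (M.onEdge Fa s s' : ℝ≥0∞) ∂M.ds := by
  have hm : AEMeasurable (fun s' ↦ (M.onEdge Fa s s' : ℝ≥0∞)) (M.ds.restrict (M.children s)) :=
    ((hM.continuousOn_onEdge_children hLa hLs s).aemeasurable
      (hM.measurableSet_children s)).coe_nnreal_ennreal
  rw [← (hM.translation s).map_eq] at hm ⊢
  rw [lintegral_map' hm (hM.translation s).measurable.aemeasurable]
  refine setLIntegral_congr_fun (hM.measurableSet_acts s) fun a ha ↦ ?_
  simp only [onEdge, action]
  rw [(hM.unique_action s).leftInvOn_invFunOn ha]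

theorem flowMatching_of_matches (hM : M.IsAcyclicTask) (hLa : ∀ s, LipschitzWith L fun a ↦ Fa s a)
    (hLs : ∀ a, LipschitzWith L fun s ↦ Fa s a) {F : M.TrajectoryFlow} (hF : M.Matches Fs Fa F) :
    M.FlowMatching Fs Fa := by
  have := hM.sigmaFinite
  refine ⟨fun s' hs' ↦ ?_, fun s hs ↦ ?_⟩
  · rw [hM.before_iff_ne_s₀] at hs'
    rw [← hF.1, F.stateFlow_eq_lintegral_edgeFlow_left hs',
      ← lintegral_indicator (hM.measurableSet_parents s')]
    refine lintegral_congr fun s ↦ ?_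
    by_cases h : M.Edge s s'
    · rw [Set.indicator_of_mem (show s ∈ M.parents s' from h), hF.2 _ _ h]
    · rw [Set.indicator_of_notMem (show s ∉ M.parents s' from h), F.edgeFlow_eq_zero h]
  · rw [hM.lintegral_acts_eq hLa hLs, and_self]
    rw [hM.before_iff_ne_sf] at hs
    rw [← hF.1, F.stateFlow_eq_lintegral_edgeFlow_right hs,
      ← lintegral_indicator (hM.measurableSet_children s)]
    refine lintegral_congr fun s' ↦ ?_
    by_cases h : M.Edge s s'
    · rw [Set.indicator_of_mem (show s' ∈ M.children s from h), hF.2 _ _ h]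
    · rw [Set.indicator_of_notMem (show s' ∉ M.children s from h), F.edgeFlow_eq_zero h]

theorem onEdge_eq_zero_of_right (hM : M.IsAcyclicTask) (hLa : ∀ s, LipschitzWith L fun a ↦ Fa s a)
    (hLs : ∀ a, LipschitzWith L fun s ↦ Fa s a)
    (hF : M.FlowMatching Fs Fa) {s s' : S} (h : M.Edge s s') (hs : Fs s' = 0) :
    M.onEdge Fa s s' = 0 := by
  have h1 := hF.1 s' (hM.before_iff_ne_s₀.2 (hM.ne_s₀_of_edge h))
  rw [hs, ENNReal.coe_zero] at h1
  exact (hM.continuousOn_onEdge_parents hLa hLs s').eq_zero_of_setLIntegral_eq_zero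
    (hM.measurableSet_parents s') (hM.ds_pos s') h1.symm _ h

end IsAcyclicTask

end

end FlowTask

/-! ### Weights of paths -/

/-- The product of the weights `K` along the steps of the path `s :: q`, times the value of `φ` at
its end. -/
def pathWeight {S : Type*} (K : S → S → ℝ≥0) (φ : S → ℝ≥0) : S → List S → ℝ≥0
  | s, [] => φ s
  | s, s' :: q => K s s' * pathWeight K φ s' q

section

variable {S : Type*} {K : S → S → ℝ≥0} {φ : S → ℝ≥0}

/-- The state `r` is the cut point: the end value `1` on the first factor keeps `φ` from being
counted before the true end. This factorization is the source of the Markov property. -/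
theorem pathWeight_append_cons (s r : S) (p q : List S) :
    pathWeight K φ s (p ++ r :: q) = pathWeight K 1 s (p ++ [r]) * pathWeight K φ r q := by
  induction p generalizing s with
  | nil => simp [pathWeight]
  | cons a p ih => simp [pathWeight, ih, mul_assoc]

theorem measurable_pathWeight [MeasurableSpace S] (hK : Measurable fun e : S × S ↦ K e.1 e.2)
    (hφ : Measurable φ) (n : ℕ) :
    Measurable fun z : S × (Fin n → S) ↦ pathWeight K φ z.1 (List.ofFn z.2) := by
  induction n with
  | zero => simpa [pathWeight, Function.comp_def] using hφ.comp measurable_fst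
  | succ n ih =>
    simp only [List.ofFn_succ, pathWeight]
    have h0 : Measurable fun z : S × (Fin (n + 1) → S) ↦ z.2 0 := by fun_prop
    have h1 : Measurable fun z : S × (Fin (n + 1) → S) ↦ (z.2 0, fun i : Fin n ↦ z.2 i.succ) := by
      fun_prop
    exact (hK.comp (measurable_fst.prodMk h0)).mul (ih.comp h1)

theorem isChain_of_pathWeight_ne_zero {E : S → S → Prop} (hK : ∀ s s', ¬ E s s' → K s s' = 0)
    {s : S} {q : List S} (h : pathWeight K φ s q ≠ 0) : (s :: q).IsChain E := by
  induction q generalizing s with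
  | nil => simp
  | cons a q ih =>
    rw [pathWeight] at h
    exact (ih (right_ne_zero_of_mul h)).cons_cons (not_imp_comm.1 (hK s a) (left_ne_zero_of_mul h))

theorem exists_getLast_of_pathWeight_ne_zero {s : S} {q : List S} (h : pathWeight K φ s q ≠ 0) :
    ∃ r, (s :: q).getLast? = some r ∧ φ r ≠ 0 := by
  induction q generalizing s with
  | nil => exact ⟨s, by simp, h⟩
  | cons a q ih =>
    obtain ⟨r, h1, h2⟩ := ih (right_ne_zero_of_mul h)
    exact ⟨r, by rw [List.getLast?_cons_cons, h1], h2⟩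

theorem pathWeight_ofFn {n : ℕ} (τ : Fin (n + 1) → S) :
    pathWeight K φ (τ 0) (List.ofFn fun i : Fin n ↦ τ i.succ) =
      (∏ i : Fin n, K (τ i.castSucc) (τ i.succ)) * φ (τ (Fin.last n)) := by
  induction n with
  | zero => simp [pathWeight]
  | succ n ih =>
    rw [List.ofFn_succ, pathWeight, Fin.prod_univ_succ, mul_assoc]
    have := ih fun i ↦ τ i.succ
    simp only [Fin.succ_last, Fin.succ_zero_eq_one] at this
    simp only [Fin.castSucc_zero, Fin.succ_zero_eq_one, Fin.castSucc_succ, this]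

end

/-! ### The Markov flow built from transition weights -/

namespace FlowTask

variable {S A : Type*} [MeasurableSpace S] [MeasurableSpace A] {M : FlowTask S A}

open Classical in
/-- The weight of a sequence of states: the value of `w` at the initial state, times the
`pathWeight`. -/
noncomputable def rootWeight (M : FlowTask S A) (w : ℝ≥0) (K : S → S → ℝ≥0) (φ : S → ℝ≥0) :
    List S → ℝ≥0
  | [] => 0
  | s :: q => (if s = M.s₀ then w else 0) * pathWeight K φ s q

section

variable {w : ℝ≥0} {K : S → S → ℝ≥0} {φ : S → ℝ≥0}

theorem rootWeight_append_cons (p q : List S) (r : S) :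
    M.rootWeight w K φ (p ++ r :: q) = M.rootWeight w K 1 (p ++ [r]) * pathWeight K φ r q := by
  cases p with
  | nil => simp [rootWeight, pathWeight]
  | cons a p => simp [rootWeight, pathWeight_append_cons a r p q, mul_assoc]

theorem rootWeight_append_pair (p : List S) (r s : S) :
    M.rootWeight w K 1 (p ++ [r, s]) = M.rootWeight w K 1 (p ++ [r]) * K r s := by
  rw [rootWeight_append_cons]
  simp [pathWeight]

theorem measurable_rootWeight [MeasurableSingletonClass S]
    (hK : Measurable fun e : S × S ↦ K e.1 e.2) (hφ : Measurable φ) (n : ℕ) :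
    Measurable fun x : Fin n → S ↦ M.rootWeight w K φ (List.ofFn x) := by
  cases n with
  | zero => simp [rootWeight]
  | succ n =>
    simp only [List.ofFn_succ, rootWeight]
    have h0 : Measurable fun x : Fin (n + 1) → S ↦ x 0 := by fun_prop
    have h1 : Measurable fun x : Fin (n + 1) → S ↦ (x 0, fun i : Fin n ↦ x i.succ) := by
      fun_prop
    refine Measurable.mul ?_ ((measurable_pathWeight hK hφ n).comp h1)
    exact Measurable.ite (h0 (measurableSet_singleton M.s₀)) measurable_const measurable_const

end

open Classical in
/-- The transition weight `F̂(s → s') / F̂(s)`, zero if `s → s'` is not a transition. -/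
noncomputable def forwardWeight [Nonempty A] (M : FlowTask S A) (Fs : S → ℝ≥0) (Fa : S → A → ℝ≥0)
    (s s' : S) : ℝ≥0 :=
  if M.Edge s s' then M.onEdge Fa s s' / Fs s else 0

theorem forwardWeight_of_edge [Nonempty A] {Fs : S → ℝ≥0} {Fa : S → A → ℝ≥0} {s s' : S}
    (h : M.Edge s s') :
    M.forwardWeight Fs Fa s s' = M.onEdge Fa s s' / Fs s := if_pos h

theorem forwardWeight_of_not_edge [Nonempty A] {Fs : S → ℝ≥0} {Fa : S → A → ℝ≥0} {s s' : S}
    (h : ¬ M.Edge s s') :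
    M.forwardWeight Fs Fa s s' = 0 := if_neg h

open Classical in
/-- The indicator of the final state. -/
noncomputable def atFinal (M : FlowTask S A) (s : S) : ℝ≥0 := if s = M.sf then 1 else 0

theorem measurable_atFinal [MeasurableSingletonClass S] : Measurable M.atFinal :=
  Measurable.ite (measurableSet_singleton M.sf) measurable_const measurable_const

section

variable [Nonempty A] {Fs : S → ℝ≥0} {Fa : S → A → ℝ≥0} {L : ℝ≥0}

/-- The flow that starts with `F̂(s₀)` and branches according to the transition weights. -/
noncomputable def markovFlow [MeasurableSingletonClass S] (M : FlowTask S A) (Fs : S → ℝ≥0)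
    (Fa : S → A → ℝ≥0)
    (hK : Measurable fun e : S × S ↦ M.forwardWeight Fs Fa e.1 e.2) : M.TrajectoryFlow where
  toFun := M.rootWeight (Fs M.s₀) (M.forwardWeight Fs Fa) M.atFinal
  measurable_toFun := measurable_rootWeight hK measurable_atFinal
  eq_zero τ hτ := by
    by_contra hne
    refine hτ ?_
    cases τ with
    | nil => exact absurd rfl hne
    | cons s q =>
      have h1 := right_ne_zero_of_mul hne
      have h2 := left_ne_zero_of_mul hne
      obtain ⟨r, hr, hφ⟩ := exists_getLast_of_pathWeight_ne_zero h1
      refine ⟨isChain_of_pathWeight_ne_zero (fun _ _ ↦ forwardWeight_of_not_edge) h1, ?_, ?_⟩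
      · by_contra hs
        exact h2 (if_neg (by simpa using hs))
      · rw [hr]
        simpa [atFinal] using hφ

namespace IsAcyclicTask

variable [MetricSpace S] [MetricSpace A]

theorem forwardWeight_mul [OpensMeasurableSpace A] (hM : M.IsAcyclicTask)
    (hLa : ∀ s, LipschitzWith L fun a ↦ Fa s a)
    (hF : M.FlowMatching Fs Fa) {s s' : S} (h : M.Edge s s') :
    Fs s * M.forwardWeight Fs Fa s s' = M.onEdge Fa s s' := by
  rw [forwardWeight_of_edge h]
  by_cases hs : Fs s = 0
  · rw [hs, hM.onEdge_eq_zero_of_left hLa hF h hs, zero_mul]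
  · exact mul_div_cancel₀ _ hs

/-- Division by zero is zero in `ℝ≥0` but may be infinite in `ℝ≥0∞`. The two quotients agree because
the numerator vanishes with `Fs s`. -/
theorem coe_forwardWeight [OpensMeasurableSpace A] (hM : M.IsAcyclicTask)
    (hLa : ∀ s, LipschitzWith L fun a ↦ Fa s a)
    (hF : M.FlowMatching Fs Fa) {s s' : S} (h : M.Edge s s') :
    (M.forwardWeight Fs Fa s s' : ℝ≥0∞) = M.onEdge Fa s s' / Fs s := by
  rw [forwardWeight_of_edge h]
  by_cases hs : Fs s = 0
  · simp [hs, hM.onEdge_eq_zero_of_left hLa hF h hs]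
  · exact ENNReal.coe_div hs

variable [SecondCountableTopology S] [OpensMeasurableSpace S]

theorem measurable_onEdge_indicator (hM : M.IsAcyclicTask)
    (hLa : ∀ s, LipschitzWith L fun a ↦ Fa s a)
    (hLs : ∀ a, LipschitzWith L fun s ↦ Fa s a) :
    Measurable ({e : S × S | M.Edge e.1 e.2}.indicator fun e ↦ M.onEdge Fa e.1 e.2) := by
  classical
  rw [← Set.piecewise_eq_indicator]
  exact (hM.continuousOn_onEdge hLa hLs).measurable_piecewise continuousOn_const
    hM.measurableSet_edges

/-- Away from `s₀` the inflow condition exhibits `Fs` as a parametric integral of a jointly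
measurable function; the single point `s₀` is treated apart. -/
theorem measurable_stateValue (hM : M.IsAcyclicTask) (hLa : ∀ s, LipschitzWith L fun a ↦ Fa s a)
    (hLs : ∀ a, LipschitzWith L fun s ↦ Fa s a) (hF : M.FlowMatching Fs Fa) : Measurable Fs := by
  classical
  have := hM.sigmaFinite
  have h : (fun s' ↦ (Fs s' : ℝ≥0∞)) = fun s' ↦ if s' = M.s₀ then (Fs M.s₀ : ℝ≥0∞) else
      ∫⁻ s, ({e : S × S | M.Edge e.1 e.2}.indicator (fun e ↦ M.onEdge Fa e.1 e.2) (s, s') : ℝ≥0)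
        ∂M.ds := by
    funext s'
    split_ifs with hs
    · rw [hs]
    · rw [hF.1 s' (hM.s₀_before s' hs), ← lintegral_indicator (hM.measurableSet_parents s')]
      refine lintegral_congr fun s ↦ ?_
      simp only [Set.indicator_apply, parents, Set.mem_ofPred_eq]
      split_ifs <;> rfl
  have h1 : Measurable fun s' ↦ (Fs s' : ℝ≥0∞) := by
    rw [h]
    refine Measurable.ite (measurableSet_singleton M.s₀) measurable_const ?_
    exact (hM.measurable_onEdge_indicator hLa hLs).coe_nnreal_ennreal.lintegral_prod_left'
  simpa using h1.ennreal_toNNReal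

theorem measurable_forwardWeight (hM : M.IsAcyclicTask)
    (hLa : ∀ s, LipschitzWith L fun a ↦ Fa s a)
    (hLs : ∀ a, LipschitzWith L fun s ↦ Fa s a) (hF : M.FlowMatching Fs Fa) :
    Measurable fun e : S × S ↦ M.forwardWeight Fs Fa e.1 e.2 := by
  convert (hM.measurable_onEdge_indicator hLa hLs).div
    ((hM.measurable_stateValue hLa hLs hF).comp measurable_fst) using 1
  funext e
  by_cases h : M.Edge e.1 e.2
  · simp [forwardWeight, h]
  · simp [forwardWeight, h]

end IsAcyclicTask

end

end FlowTask

/-! ### Head weights and tail masses -/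

namespace FlowTask

variable {S A : Type*} [MeasurableSpace S] [MeasurableSpace A] {M : FlowTask S A}
  [Nonempty A] {Fs : S → ℝ≥0} {Fa : S → A → ℝ≥0} {L : ℝ≥0}

/-- The total weight of the paths from `s` to the final state. -/
noncomputable def tailMass (M : FlowTask S A) (Fs : S → ℝ≥0) (Fa : S → A → ℝ≥0) (s : S) : ℝ≥0∞ :=
  M.seqIntegral fun q ↦ (pathWeight (M.forwardWeight Fs Fa) M.atFinal s q : ℝ≥0∞)

/-- The weight of an initial trajectory. -/
noncomputable def headWeight (M : FlowTask S A) (Fs : S → ℝ≥0) (Fa : S → A → ℝ≥0) :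
    List S → ℝ≥0 :=
  M.rootWeight (Fs M.s₀) (M.forwardWeight Fs Fa) 1

theorem headWeight_append_pair (p : List S) (r s : S) :
    M.headWeight Fs Fa (p ++ [r, s]) =
      M.headWeight Fs Fa (p ++ [r]) * M.forwardWeight Fs Fa r s :=
  rootWeight_append_pair p r s

open Classical in
theorem headWeight_singleton (s : S) :
    M.headWeight Fs Fa [s] = if s = M.s₀ then Fs M.s₀ else 0 := by
  simp [headWeight, rootWeight, pathWeight]

section

variable [MeasurableSingletonClass S]

theorem measurable_headWeight
    (hK : Measurable fun e : S × S ↦ M.forwardWeight Fs Fa e.1 e.2)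
    {α : Type*} [MeasurableSpace α] {u : α → List S} (hu : MeasurableListMap u) :
    Measurable fun a ↦ (M.headWeight Fs Fa (u a) : ℝ≥0∞) :=
  (hu.measurable_comp (measurable_rootWeight hK measurable_const)).coe_nnreal_ennreal

theorem measurable_pathWeight_atFinal
    (hK : Measurable fun e : S × S ↦ M.forwardWeight Fs Fa e.1 e.2) (n : ℕ) :
    Measurable fun z : S × (Fin n → S) ↦
      (pathWeight (M.forwardWeight Fs Fa) M.atFinal z.1 (List.ofFn z.2) : ℝ≥0∞) :=
  (measurable_pathWeight hK measurable_atFinal n).coe_nnreal_ennreal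

theorem tailMass_eq_add_lintegral [SigmaFinite M.ds]
    (hK : Measurable fun e : S × S ↦ M.forwardWeight Fs Fa e.1 e.2) (s : S) :
    M.tailMass Fs Fa s = M.atFinal s +
      ∫⁻ s', M.forwardWeight Fs Fa s s' * M.tailMass Fs Fa s' ∂M.ds := by
  rw [tailMass, seqIntegral_cons]
  · simp only [pathWeight, ENNReal.coe_mul]
    congr 1
    refine lintegral_congr fun s' ↦ ?_
    rw [seqIntegral_const_mul, tailMass]
    exact fun n ↦ (measurable_pathWeight_atFinal hK n).comp measurable_prodMk_left
  · exact fun n ↦ (measurable_pathWeight_atFinal hK n).comp measurable_prodMk_left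

theorem prefixFlow_markovFlow
    (hK : Measurable fun e : S × S ↦ M.forwardWeight Fs Fa e.1 e.2) (p : List S) (s : S) :
    (M.markovFlow Fs Fa hK).prefixFlow (p ++ [s]) =
      M.headWeight Fs Fa (p ++ [s]) * M.tailMass Fs Fa s := by
  rw [TrajectoryFlow.prefixFlow, tailMass, ← seqIntegral_const_mul]
  · congr 1
    funext q
    rw [List.append_assoc, List.singleton_append, ← ENNReal.coe_mul]
    exact congrArg _ (rootWeight_append_cons p q s)
  · exact fun n ↦ (measurable_pathWeight_atFinal hK n).comp measurable_prodMk_left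

theorem prefixFlow_markovFlow_pair
    (hK : Measurable fun e : S × S ↦ M.forwardWeight Fs Fa e.1 e.2) (p : List S) (s s' : S) :
    (M.markovFlow Fs Fa hK).prefixFlow (p ++ [s, s']) =
      M.headWeight Fs Fa (p ++ [s]) * (M.forwardWeight Fs Fa s s' * M.tailMass Fs Fa s') := by
  have h := prefixFlow_markovFlow hK (p ++ [s]) s'
  rw [List.append_assoc] at h
  rw [← mul_assoc, ← ENNReal.coe_mul, ← headWeight_append_pair]
  exact h

end

/-! ### Existence and uniqueness of the Markovian flow -/

namespace IsAcyclicTask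

variable [MetricSpace S] [MetricSpace A]

theorem lintegral_forwardWeight (hM : M.IsAcyclicTask) (hF : M.FlowMatching Fs Fa) {s : S}
    (hs : s ≠ M.sf) (h0 : Fs s ≠ 0) : ∫⁻ s', (M.forwardWeight Fs Fa s s' : ℝ≥0∞) ∂M.ds = 1 := by
  have h1 := (hF.2 s (hM.before_sf s hs)).1
  have h2 : ∀ s', (M.forwardWeight Fs Fa s s' : ℝ≥0∞) = (M.children s).indicator
      (fun s' ↦ (M.onEdge Fa s s' : ℝ≥0∞)) s' * (Fs s : ℝ≥0∞)⁻¹ := by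
    intro s'
    by_cases h : M.Edge s s'
    · rw [Set.indicator_of_mem (show s' ∈ M.children s from h), forwardWeight_of_edge h,
        ENNReal.coe_div h0, div_eq_mul_inv]
    · rw [Set.indicator_of_notMem (show s' ∉ M.children s from h), forwardWeight_of_not_edge h]
      simp
  simp_rw [h2]
  rw [lintegral_mul_const' _ _ (by simpa using h0),
    lintegral_indicator (hM.measurableSet_children s), ← h1,
    ENNReal.mul_inv_cancel (by simpa using h0) (by simp)]

theorem forwardWeight_eq_zero_of_right [OpensMeasurableSpace S] (hM : M.IsAcyclicTask)
    (hLa : ∀ s, LipschitzWith L fun a ↦ Fa s a) (hLs : ∀ a, LipschitzWith L fun s ↦ Fa s a)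
    (hF : M.FlowMatching Fs Fa) {s s' : S} (hs : Fs s' = 0) : M.forwardWeight Fs Fa s s' = 0 := by
  by_cases h : M.Edge s s'
  · rw [forwardWeight_of_edge h, hM.onEdge_eq_zero_of_right hLa hLs hF h hs, zero_div]
  · exact forwardWeight_of_not_edge h

theorem prefixFlow_singleton (hM : M.IsAcyclicTask) {F : M.TrajectoryFlow}
    (hF : M.Matches Fs Fa F) (s : S) : F.prefixFlow [s] = M.headWeight Fs Fa [s] := by
  rw [headWeight_singleton]
  split_ifs with hs
  · rw [← hF.1, F.stateFlow_eq_seqIntegral_prefixFlow, seqIntegral_eq_nil]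
    · simp [hs]
    · intro p hp
      by_contra hne
      obtain ⟨q, hq⟩ := M.exists_ne_zero_of_seqIntegral_ne_zero hne
      have := F.isComplete_of_ne_zero (by simpa using hq)
      exact hp (hM.eq_nil_of_isComplete_s₀ this)
  · by_contra hne
    have := (F.isInitial_of_prefixFlow_ne_zero (List.cons_ne_nil s []) (by simpa using hne)).2
    exact hs (by simpa using this)

theorem prefixFlow_append_sf (hM : M.IsAcyclicTask) (F : M.TrajectoryFlow) (p : List S) :
    F.prefixFlow (p ++ [M.sf]) = F.toFun (p ++ [M.sf]) := by
  rw [TrajectoryFlow.prefixFlow, seqIntegral_eq_nil]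
  · simp
  · intro q hq
    by_contra hne
    have := F.isComplete_of_ne_zero (by simpa using hne)
    exact hq (hM.eq_nil_of_isComplete_sf this)

/-- One step of uniqueness. If the prefix has positive flow, the Markov property fixes each
extension exactly. If its flow is zero, the extensions have integral zero and so vanish only almost
everywhere; this is where the exceptional null sets arise. -/
theorem ae_prefixFlow_append_pair [OpensMeasurableSpace A] (hM : M.IsAcyclicTask)
    (hLa : ∀ s, LipschitzWith L fun a ↦ Fa s a)
    (hF : M.FlowMatching Fs Fa) {F : M.TrajectoryFlow} (hFm : M.Matches Fs Fa F)
    (hMk : F.IsMarkovian) {p : List S} {s : S}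
    (h : F.prefixFlow (p ++ [s]) = M.headWeight Fs Fa (p ++ [s])) :
    ∀ᵐ s' ∂M.ds, F.prefixFlow (p ++ [s, s']) = M.headWeight Fs Fa (p ++ [s, s']) := by
  have := hM.sigmaFinite
  by_cases h0 : M.headWeight Fs Fa (p ++ [s]) = 0
  · have h1 : ∫⁻ s', F.prefixFlow (p ++ [s, s']) ∂M.ds = 0 := by
      have h2 := F.prefixFlow_eq_add_lintegral (p ++ [s])
      rw [h, h0, ENNReal.coe_zero] at h2
      simpa using (add_eq_zero.1 h2.symm).2
    have hm : Measurable fun s' ↦ F.prefixFlow (p ++ [s, s']) := F.measurable_prefixFlow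
      (.append (.const _) (.cons measurable_const (.cons measurable_id .nil)))
    rw [lintegral_eq_zero_iff hm] at h1
    filter_upwards [h1] with s' hs'
    rw [hs', headWeight_append_pair, h0]
    simp
  · refine Filter.Eventually.of_forall fun s' ↦ ?_
    rw [headWeight_append_pair]
    by_cases hE : M.Edge s s'
    · have hne : F.prefixFlow (p ++ [s]) ≠ 0 := by simpa [h] using h0
      have hnt : F.prefixFlow (p ++ [s]) ≠ ∞ := by simp [h]
      have h1 := hMk p s s' (F.isInitial_of_prefixFlow_ne_zero (by simp) hne) hE hne hnt
      rw [hFm.1, hFm.2 _ _ hE, ← hM.coe_forwardWeight hLa hF hE] at h1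
      rw [← ENNReal.div_mul_cancel (b := F.prefixFlow (p ++ [s, s'])) hne hnt, h1, h,
        ENNReal.coe_mul, mul_comm]
    · rw [F.prefixFlow_eq_zero_of_not_edge _ hE, forwardWeight_of_not_edge hE]
      simp

variable [SecondCountableTopology S] [OpensMeasurableSpace S]

/-- Backward induction from `sf`. Children with `Fs s' = 0` escape the induction hypothesis but
carry transition weight zero, and the remaining weights integrate to 1. -/
theorem tailMass_eq_one (hM : M.IsAcyclicTask)
    (hLa : ∀ s, LipschitzWith L fun a ↦ Fa s a) (hLs : ∀ a, LipschitzWith L fun s ↦ Fa s a)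
    (hF : M.FlowMatching Fs Fa) {s : S} (hs : Fs s ≠ 0) : M.tailMass Fs Fa s = 1 := by
  have := hM.sigmaFinite
  induction s using hM.wellFounded_edge_swap.induction with
  | h s ih =>
  rw [tailMass_eq_add_lintegral (hM.measurable_forwardWeight hLa hLs hF)]
  by_cases hsf : s = M.sf
  · have h0 : ∀ s', M.forwardWeight Fs Fa s s' = 0 := fun s' ↦
      forwardWeight_of_not_edge (hsf ▸ hM.not_edge_sf s')
    simp only [h0]
    simp [hsf, atFinal]
  · have h1 : ∀ s', (M.forwardWeight Fs Fa s s' : ℝ≥0∞) * M.tailMass Fs Fa s' =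
        M.forwardWeight Fs Fa s s' := by
      intro s'
      by_cases h : M.Edge s s'
      · by_cases h0 : Fs s' = 0
        · rw [hM.forwardWeight_eq_zero_of_right hLa hLs hF h0]
          simp
        · rw [ih s' h h0, mul_one]
      · rw [forwardWeight_of_not_edge h]
        simp
    simp only [h1]
    rw [hM.lintegral_forwardWeight hF hsf hs]
    simp [atFinal, hsf]

theorem forwardWeight_mul_tailMass (hM : M.IsAcyclicTask)
    (hLa : ∀ s, LipschitzWith L fun a ↦ Fa s a) (hLs : ∀ a, LipschitzWith L fun s ↦ Fa s a)
    (hF : M.FlowMatching Fs Fa) (s s' : S) :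
    (M.forwardWeight Fs Fa s s' : ℝ≥0∞) * M.tailMass Fs Fa s' = M.forwardWeight Fs Fa s s' := by
  by_cases h0 : Fs s' = 0
  · rw [hM.forwardWeight_eq_zero_of_right hLa hLs hF h0]
    simp
  · rw [hM.tailMass_eq_one hLa hLs hF h0, mul_one]

variable [OpensMeasurableSpace A]

/-- Forward induction along transitions: splitting off the last parent `r` gives `Fs r` times the
transition weight, which is the edge value, and the inflow condition sums these. At `s₀` only the
empty past contributes. -/
theorem seqIntegral_headWeight (hM : M.IsAcyclicTask)
    (hLa : ∀ s, LipschitzWith L fun a ↦ Fa s a) (hLs : ∀ a, LipschitzWith L fun s ↦ Fa s a)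
    (hF : M.FlowMatching Fs Fa) (s : S) :
    (M.seqIntegral fun p ↦ (M.headWeight Fs Fa (p ++ [s]) : ℝ≥0∞)) = Fs s := by
  have := hM.sigmaFinite
  have hK := hM.measurable_forwardWeight hLa hLs hF
  have hm : ∀ (s : S) (n : ℕ), Measurable fun x : Fin n → S ↦
      (M.headWeight Fs Fa (List.ofFn x ++ [s]) : ℝ≥0∞) := fun s n ↦
    measurable_headWeight hK (.append (.ofFn measurable_id) (.const _))
  induction s using hM.wellFounded_edge.induction with
  | h s ih =>
  rw [seqIntegral_snoc M (f := fun p ↦ (M.headWeight Fs Fa (p ++ [s]) : ℝ≥0∞)) (hm s)]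
  have h1 : ∀ r, (M.seqIntegral fun p ↦ (M.headWeight Fs Fa (p ++ [r] ++ [s]) : ℝ≥0∞)) =
      (M.parents s).indicator (fun r ↦ (M.onEdge Fa r s : ℝ≥0∞)) r := by
    intro r
    simp only [List.append_assoc, List.singleton_append, headWeight_append_pair, ENNReal.coe_mul]
    rw [seqIntegral_mul_const M (f := fun p ↦ (M.headWeight Fs Fa (p ++ [r]) : ℝ≥0∞)) (hm r)]
    by_cases h : M.Edge r s
    · rw [Set.indicator_of_mem (show r ∈ M.parents s from h), ih r h, ← ENNReal.coe_mul,
        hM.forwardWeight_mul hLa hF h]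
    · rw [Set.indicator_of_notMem (show r ∉ M.parents s from h), forwardWeight_of_not_edge h]
      simp
  simp only [h1]
  rw [lintegral_indicator (hM.measurableSet_parents s), List.nil_append, headWeight_singleton]
  split_ifs with hs
  · have h2 : M.parents s = ∅ := Set.eq_empty_of_forall_notMem fun r hr ↦
      hM.not_edge_s₀ r (hs ▸ hr)
    rw [h2, hs]
    simp
  · rw [hF.1 s (hM.s₀_before s hs)]
    simp

theorem matches_markovFlow (hM : M.IsAcyclicTask)
    (hLa : ∀ s, LipschitzWith L fun a ↦ Fa s a) (hLs : ∀ a, LipschitzWith L fun s ↦ Fa s a)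
    (hF : M.FlowMatching Fs Fa) :
    M.Matches Fs Fa (M.markovFlow Fs Fa (hM.measurable_forwardWeight hLa hLs hF)) := by
  have hK := hM.measurable_forwardWeight hLa hLs hF
  have hm : ∀ (s : S) (n : ℕ), Measurable fun x : Fin n → S ↦
      (M.headWeight Fs Fa (List.ofFn x ++ [s]) : ℝ≥0∞) := fun s n ↦
    measurable_headWeight hK (.append (.ofFn measurable_id) (.const _))
  refine ⟨fun s ↦ ?_, fun s s' h ↦ ?_⟩
  · rw [TrajectoryFlow.stateFlow_eq_seqIntegral_prefixFlow]
    simp only [prefixFlow_markovFlow]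
    rw [seqIntegral_mul_const M (f := fun p ↦ (M.headWeight Fs Fa (p ++ [s]) : ℝ≥0∞)) (hm s),
      hM.seqIntegral_headWeight hLa hLs hF]
    by_cases h0 : Fs s = 0
    · simp [h0]
    · rw [hM.tailMass_eq_one hLa hLs hF h0, mul_one]
  · rw [TrajectoryFlow.edgeFlow_eq_seqIntegral_prefixFlow]
    simp only [prefixFlow_markovFlow_pair, hM.forwardWeight_mul_tailMass hLa hLs hF]
    rw [seqIntegral_mul_const M (f := fun p ↦ (M.headWeight Fs Fa (p ++ [s]) : ℝ≥0∞)) (hm s),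
      hM.seqIntegral_headWeight hLa hLs hF, ← ENNReal.coe_mul, hM.forwardWeight_mul hLa hF h]

theorem isMarkovian_markovFlow (hM : M.IsAcyclicTask)
    (hLa : ∀ s, LipschitzWith L fun a ↦ Fa s a) (hLs : ∀ a, LipschitzWith L fun s ↦ Fa s a)
    (hF : M.FlowMatching Fs Fa) :
    (M.markovFlow Fs Fa (hM.measurable_forwardWeight hLa hLs hF)).IsMarkovian := by
  intro p s s' _ hE h0 _
  have hmatch := hM.matches_markovFlow hLa hLs hF
  rw [hmatch.1, hmatch.2 _ _ hE, ← hM.coe_forwardWeight hLa hF hE, prefixFlow_markovFlow_pair,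
    hM.forwardWeight_mul_tailMass hLa hLs hF]
  -- Here the transition weight is a division by zero, hence 0, and both sides vanish.
  by_cases hs : Fs s = 0
  · simp [forwardWeight, hs]
  · rw [prefixFlow_markovFlow, hM.tailMass_eq_one hLa hLs hF hs, mul_one] at h0 ⊢
    rw [mul_comm, mul_div_assoc, ENNReal.div_self h0 (by simp), mul_one]

theorem markovFlow_ofFn (hM : M.IsAcyclicTask)
    (hLa : ∀ s, LipschitzWith L fun a ↦ Fa s a) (hLs : ∀ a, LipschitzWith L fun s ↦ Fa s a)
    (hF : M.FlowMatching Fs Fa) {n : ℕ} {τ : Fin (n + 2) → S} (hτ : M.IsComplete (List.ofFn τ)) :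
    (M.markovFlow Fs Fa (hM.measurable_forwardWeight hLa hLs hF)).toFun (List.ofFn τ) =
      (∏ i : Fin (n + 1), M.onEdge Fa (τ i.castSucc) (τ i.succ)) /
        ∏ i : Fin n, Fs (τ i.succ.castSucc) := by
  obtain ⟨h1, h2, h3⟩ := hτ
  have hs₀ : τ 0 = M.s₀ := by simpa [List.ofFn_succ] using h2
  have hsf : τ (Fin.last (n + 1)) = M.sf := by
    rw [List.ofFn_succ', List.concat_eq_append, List.getLast?_concat] at h3
    exact Option.some.inj h3
  have hE : ∀ i : Fin (n + 1), M.Edge (τ i.castSucc) (τ i.succ) := fun i ↦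
    (List.isChain_ofFn.1 h1) i (by omega)
  simp only [markovFlow]
  rw [List.ofFn_succ, rootWeight, if_pos hs₀, pathWeight_ofFn, hsf]
  simp only [forwardWeight_of_edge (hE _), Finset.prod_div_distrib, atFinal, if_true, mul_one]
  -- The transition weights also put `Fs s₀` in the denominator; it cancels against the initial
  -- mass. If it is zero, the first edge value in the numerator vanishes too.
  rw [Fin.prod_univ_succ fun i : Fin (n + 1) ↦ Fs (τ i.castSucc), Fin.castSucc_zero, hs₀]
  by_cases h0 : Fs M.s₀ = 0
  · have : ∏ i : Fin (n + 1), M.onEdge Fa (τ i.castSucc) (τ i.succ) = 0 :=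
      Finset.prod_eq_zero (Finset.mem_univ 0)
        (hM.onEdge_eq_zero_of_left hLa hF (hE 0) (by rw [Fin.castSucc_zero, hs₀, h0]))
    simp [this]
  · rw [← mul_div_assoc, mul_div_mul_left _ _ h0]

theorem ae_prefixFlow_eq_headWeight (hM : M.IsAcyclicTask)
    (hLa : ∀ s, LipschitzWith L fun a ↦ Fa s a) (hLs : ∀ a, LipschitzWith L fun s ↦ Fa s a)
    (hF : M.FlowMatching Fs Fa) {F : M.TrajectoryFlow} (hFm : M.Matches Fs Fa F)
    (hMk : F.IsMarkovian) (n : ℕ) :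
    ∀ᵐ x ∂(Measure.pi fun _ : Fin (n + 1) ↦ M.ds),
      F.prefixFlow (List.ofFn x) = M.headWeight Fs Fa (List.ofFn x) := by
  have := hM.sigmaFinite
  have hK := hM.measurable_forwardWeight hLa hLs hF
  induction n with
  | zero => exact Filter.Eventually.of_forall fun x ↦ by simpa using hM.prefixFlow_singleton hFm _
  | succ n ih =>
    have hm : MeasurableSet {x : Fin (n + 2) → S |
        F.prefixFlow (List.ofFn x) = M.headWeight Fs Fa (List.ofFn x)} :=
      measurableSet_eq_fun (F.measurable_prefixFlow (.ofFn measurable_id))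
        (measurable_headWeight hK (.ofFn measurable_id))
    refine ae_pi_of_ae_ae_snoc hm ?_
    filter_upwards [ih] with y hy
    simp only [List.ofFn_snoc]
    -- The sequence `y` is nonempty and is written as `p ++ [s]`, so that the one-step lemma
    -- applies.
    rw [List.ofFn_succ', List.concat_eq_append] at hy ⊢
    simpa using hM.ae_prefixFlow_append_pair hLa hF hFm hMk hy

theorem ae_toFun_eq (hM : M.IsAcyclicTask)
    (hLa : ∀ s, LipschitzWith L fun a ↦ Fa s a) (hLs : ∀ a, LipschitzWith L fun s ↦ Fa s a)
    (hF : M.FlowMatching Fs Fa) {F F' : M.TrajectoryFlow} (hFm : M.Matches Fs Fa F)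
    (hMk : F.IsMarkovian) (hFm' : M.Matches Fs Fa F') (hMk' : F'.IsMarkovian) (n : ℕ) :
    ∀ᵐ x ∂(Measure.pi fun _ : Fin n ↦ M.ds), F'.toFun (List.ofFn x) = F.toFun (List.ofFn x) := by
  cases n with
  | zero =>
    have h : ¬ M.IsComplete [] := fun h ↦ by simpa using h.2.1
    exact Filter.Eventually.of_forall fun x ↦ by simp [F.eq_zero _ h, F'.eq_zero _ h]
  | succ n =>
    filter_upwards [hM.ae_prefixFlow_eq_headWeight hLa hLs hF hFm hMk n,
      hM.ae_prefixFlow_eq_headWeight hLa hLs hF hFm' hMk' n] with x hx hx'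
    -- A complete sequence ends in `sf`, where prefix flow and flow value coincide; elsewhere both
    -- flows are zero.
    by_cases hc : M.IsComplete (List.ofFn x)
    · obtain ⟨p, hp⟩ := List.getLast?_eq_some_iff.1 hc.2.2
      rw [hp] at hx hx' ⊢
      rw [hM.prefixFlow_append_sf] at hx hx'
      exact_mod_cast hx'.trans hx.symm
    · rw [F.eq_zero _ hc, F'.eq_zero _ hc]

end IsAcyclicTask

end FlowTask

theorem theorem1 {S A : Type*}
    [MetricSpace S] [SecondCountableTopology S] [MeasurableSpace S] [BorelSpace S]
    [MetricSpace A] [SecondCountableTopology A] [MeasurableSpace A] [BorelSpace A] [Nonempty A]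
    (M : FlowTask S A) (hM : M.IsAcyclicTask)
    (Fs : S → ℝ≥0) (Fa : S → A → ℝ≥0) (L : ℝ≥0)
    (hLa : ∀ s, LipschitzWith L fun a ↦ Fa s a)
    (hLs : ∀ a, LipschitzWith L fun s ↦ Fa s a) :
    ((∃ F : M.TrajectoryFlow, M.Matches Fs Fa F) ↔ M.FlowMatching Fs Fa) ∧
    (M.FlowMatching Fs Fa →
      ∃ F : M.TrajectoryFlow, M.Matches Fs Fa F ∧ F.IsMarkovian ∧
        (∀ (n : ℕ) (τ : Fin (n + 2) → S), M.IsComplete (List.ofFn τ) →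
          F.toFun (List.ofFn τ) =
            (∏ i : Fin (n + 1), M.onEdge Fa (τ i.castSucc) (τ i.succ)) /
              ∏ i : Fin n, Fs (τ i.succ.castSucc)) ∧
        ∀ F' : M.TrajectoryFlow, M.Matches Fs Fa F' → F'.IsMarkovian →
          ∀ n : ℕ, ∀ᵐ τ ∂(Measure.pi fun _ : Fin n ↦ M.ds),
            F'.toFun (List.ofFn τ) = F.toFun (List.ofFn τ)) := by
  refine ⟨⟨fun ⟨F, hF⟩ ↦ hM.flowMatching_of_matches hLa hLs hF,
    fun hF ↦ ⟨_, hM.matches_markovFlow hLa hLs hF⟩⟩, fun hF ↦ ?_⟩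
  have hm := hM.matches_markovFlow hLa hLs hF
  have hMk := hM.isMarkovian_markovFlow hLa hLs hF
  exact ⟨_, hm, hMk, fun n τ hτ ↦ hM.markovFlow_ofFn hLa hLs hF hτ,
    fun F' hm' hMk' n ↦ hM.ae_toFun_eq hLa hLs hF hm hMk hm' hMk' n⟩
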